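/- Let $n\ge 0$ be an integer. A set $\Omega\subset\mathbb R^d$ is called nearly convex if there is a convex set $C\subset\mathbb R^d$ with $C\subset\Omega\subset\overline C$. For $f\colon\mathbb R^n\to[-\infty,\infty]$ put $\operatorname{dom} f=\{x\in\mathbb R^n : f(x)<\infty\}$ and $\operatorname{epi} f=\{(x,\lambda)\in\mathbb R^n\times\mathbb R : f(x)\le\lambda\}$. The function $f$ is nearly convex if $\operatorname{epi} f$ is a nearly convex set, and proper if $\operatorname{dom} f\ne\emptyset$ and $f(x)>-\infty$ for all $x\in\mathbb R^n$. Its Fenchel conjugate is $f^*(w)=\sup\{\langle w,x\rangle-f(x) : x\in\mathbb R^n\}$ for $w\in\mathbb R^n$, and for functions $g,h\colon\mathbb R^n\to(-\infty,\infty]$ the infimal convolution is $(g\,\square\,h)(x)=\inf\{g(x_1)+h(x_2) : x_1,x_2\in\mathbb R^n,\ x_1+x_2=x\}$. Let $\operatorname{ri}$ denote the relative interior of a set, that is, its interior relative to its affine hull. **Theorem.** Let $f_1,f_2\colon\mathbb R^n\to[-\infty,\infty]$ be proper nearly convex functions such that $\operatorname{ri}(\operatorname{dom} f_1)\cap\operatorname{ri}(\operatorname{dom}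 f_2)\neq\emptyset$. Then $$(f_1+f_2)^*(w)=(f_1^*\,\square\,f_2^*)(w)\quad\text{for all } w\in\mathbb R^n.$$ In addition, for every $w\in\mathbb R^n$ with $(f_1+f_2)^*(w)\in\mathbb R$ there exist $w_1,w_2\in\mathbb R^n$ such that $w=w_1+w_2$ and $(f_1+f_2)^*(w)=f_1^*(w_1)+f_2^*(w_2)$. -/

import Mathlib

namespace NearConvexity

/-- A set `Ω` is nearly convex if `C ⊆ Ω ⊆ closure C` for some convex set `C`. -/
def NearlyConvexSet {E : Type*} [AddCommGroup E] [Module ℝ E] [TopologicalSpace E]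
    (Ω : Set E) : Prop :=
  ∃ C : Set E, Convex ℝ C ∧ C ⊆ Ω ∧ Ω ⊆ closure C

/-- The effective domain of an extended-real-valued function. -/
def effDom {E : Type*} (f : E → EReal) : Set E :=
  {x | f x < ⊤}

/-- The epigraph of an extended-real-valued function, a subset of `E × ℝ`. -/
def epi {E : Type*} (f : E → EReal) : Set (E × ℝ) :=
  {p | f p.1 ≤ (p.2 : EReal)}

/-- A function is nearly convex if its epigraph is a nearly convex set. -/
def NearlyConvexFun {E : Type*} [AddCommGroup E] [Module ℝ E] [TopologicalSpace E]
    (f : E → EReal) : Prop :=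
  NearlyConvexSet (epi f)

/-- A function is proper if its effective domain is nonempty and it never takes the value `-∞`. -/
def ProperFun {E : Type*} (f : E → EReal) : Prop :=
  (effDom f).Nonempty ∧ ∀ x, ⊥ < f x

/-- The Fenchel conjugate `f*(w) = sup {⟨w, x⟩ - f x | x ∈ E}`. -/
noncomputable def fenchelConj {E : Type*} [NormedAddCommGroup E] [InnerProductSpace ℝ E]
    (f : E → EReal) (w : E) : EReal :=
  ⨆ x : E, ((inner ℝ w x : ℝ) : EReal) - f x

/-- The infimal convolution `(g □ h)(x) = inf {g x₁ + h x₂ | x₁ + x₂ = x}`. It is used only for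
functions that never take the value `-∞`, so that no sum `∞ + (-∞)` occurs. -/
noncomputable def infConv {E : Type*} [AddCommGroup E] (g h : E → EReal) (x : E) : EReal :=
  sInf {y : EReal | ∃ x₁ x₂ : E, x₁ + x₂ = x ∧ y = g x₁ + h x₂}

end NearConvexity

namespace NearConvexity

open Set Topology

/-! ### Separation of a cone or convex set from below by a linear functional, without topology. -/

section Algebra

variable {F : Type*} [AddCommGroup F] [Module ℝ F]

/-! The inequality `≤` is Fenchel–Young and needs no convexity (`fenchelConj_add_le`). For the
converse, let `r` bound the conjugate of the sum at `w`, and let `C₁`, `C₂` be the convex cores of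
the epigraphs. The points `(x - y, a + b - ⟨w, x⟩ + r)` with `(x, a) ∈ C₁`, `(y, b) ∈ C₂` form a
convex set whose heights over `0` are nonnegative. A common relative interior point of the domains
lets each `u` in its projection be reversed to some `-ε u` (`eventually_prolong_mem`), so the
generated cone projects onto a subspace. M. Riesz extension then yields a linear minorant
(`exists_linear_minorant`). Its representing vector `y` gives the splitting `w = (w - y) + y`; the
inequality is closed, so it passes from the cores to the full epigraphs. -/

/-- The pointed cone generated by a nonempty convex set. -/
def generatedCone (A : Set F) (hA : Convex ℝ A) (hne : A.Nonempty) : PointedCone ℝ F where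
  carrier := {p | ∃ t : ℝ, 0 ≤ t ∧ ∃ a ∈ A, p = t • a}
  zero_mem' := ⟨0, le_rfl, hne.some, hne.some_mem, by simp⟩
  add_mem' := by
    rintro _ _ ⟨t, ht, a, ha, rfl⟩ ⟨s, hs, b, hb, rfl⟩
    rcases (add_nonneg ht hs).eq_or_lt with h | h
    · obtain rfl : t = 0 := by linarith
      obtain rfl : s = 0 := by linarith
      exact ⟨0, le_rfl, a, ha, by simp⟩
    · refine ⟨t + s, h.le, _, convex_iff_div.1 hA ha hb ht hs h, ?_⟩
      rw [smul_add, smul_smul, smul_smul, mul_div_cancel₀ _ h.ne', mul_div_cancel₀ _ h.ne']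
  smul_mem' := by
    rintro c _ ⟨t, ht, a, ha, rfl⟩
    exact ⟨c * t, mul_nonneg c.2 ht, a, ha, by rw [mul_smul]; rfl⟩

theorem mem_generatedCone {A : Set F} {hA : Convex ℝ A} {hne : A.Nonempty} {p : F} :
    p ∈ generatedCone A hA hne ↔ ∃ t : ℝ, 0 ≤ t ∧ ∃ a ∈ A, p = t • a :=
  Iff.rfl

/-- A cone in `F × ℝ` that contains no downward vertical vector, and whose projection to `F` is
symmetric, lies above the graph of a linear functional. -/
theorem exists_linear_minorant_of_cone (K : PointedCone ℝ (F × ℝ))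
    (hK : ∀ s, ((0, s) : F × ℝ) ∈ K → 0 ≤ s)
    (hsymm : ∀ u s, ((u, s) : F × ℝ) ∈ K → ∃ s', ((-u, s') : F × ℝ) ∈ K) :
    ∃ g : F →ₗ[ℝ] ℝ, ∀ p ∈ K, 0 ≤ g p.1 + p.2 := by
  have hsmul : ∀ (c : ℝ), 0 ≤ c → ∀ u s, ((u, s) : F × ℝ) ∈ K → ((c • u, c * s) : F × ℝ) ∈ K :=
    fun c hc u s h => K.smul_mem hc h
  let V : Submodule ℝ F :=
    { carrier := {u | ∃ s, ((u, s) : F × ℝ) ∈ K}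
      zero_mem' := ⟨0, K.zero_mem⟩
      add_mem' := fun ⟨s, hs⟩ ⟨t, ht⟩ => ⟨s + t, K.add_mem hs ht⟩
      smul_mem' := by
        rintro c u ⟨s, hs⟩
        rcases le_total 0 c with hc | hc
        · exact ⟨_, hsmul c hc u s hs⟩
        · obtain ⟨s', hs'⟩ := hsymm u s hs
          exact ⟨-c * s', by simpa using hsmul (-c) (neg_nonneg.2 hc) _ _ hs'⟩ }
  obtain ⟨W, hVW⟩ := V.exists_isCompl
  -- Start from the height on `W × ℝ`: the cone meets this subspace only over `0`, where `hK` gives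
  -- positivity.
  let f : (F × ℝ) →ₗ.[ℝ] ℝ :=
    ⟨W.prod ⊤, (LinearMap.snd ℝ F ℝ).comp (W.prod ⊤).subtype⟩
  obtain ⟨g, hgf, hg⟩ := riesz_extension K f (by
      rintro ⟨⟨u, s⟩, hu⟩ hus
      have hu0 : u = 0 :=
        Submodule.disjoint_def.1 hVW.disjoint u ⟨s, hus⟩ (Submodule.mem_prod.1 hu).1
      subst hu0
      exact hK s hus) (by
      rintro ⟨u, s⟩
      obtain ⟨v, ⟨t, ht⟩, w, hw, rfl⟩ := Submodule.mem_sup.1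
        (show u ∈ V ⊔ W from hVW.sup_eq_top ▸ Submodule.mem_top)
      -- This shift removes the `W`-component and moves the height to `t`, landing on `(v, t)` in
      -- the cone.
      refine ⟨⟨(-w, t - s), Submodule.mem_prod.2 ⟨W.neg_mem hw, trivial⟩⟩, ?_⟩
      simpa using ht)
  refine ⟨g.comp (LinearMap.inl ℝ F ℝ), fun p hp => ?_⟩
  have h1 : g (0, p.2) = p.2 := hgf ⟨(0, p.2), Submodule.mem_prod.2 ⟨W.zero_mem, trivial⟩⟩
  have h2 : g p = g (p.1, 0) + g (0, p.2) := by rw [← map_add]; simp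
  have h3 := hg p hp
  rw [h2, h1] at h3
  simpa using h3

/-- A convex set in `F × ℝ` with no point below the origin, and whose projection to `F` is
absorbing in the directions opposite to its elements, lies above the graph of a linear
functional. -/
theorem exists_linear_minorant {A : Set (F × ℝ)} (hA : Convex ℝ A) (hne : A.Nonempty)
    (h0 : ∀ s, ((0, s) : F × ℝ) ∈ A → 0 ≤ s)
    (hopp : ∀ u s, ((u, s) : F × ℝ) ∈ A → ∃ ε : ℝ, 0 < ε ∧ ∃ s', ((-(ε • u), s') : F × ℝ) ∈ A) :
    ∃ g : F →ₗ[ℝ] ℝ, ∀ p ∈ A, 0 ≤ g p.1 + p.2 := by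
  obtain ⟨g, hg⟩ := exists_linear_minorant_of_cone (generatedCone A hA hne) (by
      rintro s ⟨t, ht, ⟨u, r⟩, ha, h⟩
      simp only [Prod.smul_mk, Prod.mk.injEq, smul_eq_mul] at h
      rcases ht.eq_or_lt with rfl | ht'
      · simp [h.2]
      · obtain rfl : u = 0 := (smul_eq_zero.1 h.1.symm).resolve_left ht'.ne'
        rw [h.2]
        exact mul_nonneg ht (h0 r ha)) (by
      rintro u s ⟨t, ht, ⟨v, r⟩, ha, h⟩
      simp only [Prod.smul_mk, Prod.mk.injEq, smul_eq_mul] at h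
      obtain ⟨ε, hε, s', hs'⟩ := hopp v r ha
      refine ⟨t * ε⁻¹ * s', t * ε⁻¹, by positivity, _, hs', ?_⟩
      simp only [Prod.smul_mk, smul_eq_mul, h.1, smul_neg, smul_smul]
      rw [inv_mul_cancel_right₀ hε.ne'])
  exact ⟨g, fun p hp => hg p ⟨1, zero_le_one, p, hp, (one_smul _ _).symm⟩⟩

end Algebra

/-! ### Relative interiors of nearly convex sets. -/

section RelativeInterior

variable {E : Type*} [NormedAddCommGroup E] [NormedSpace ℝ E] [FiniteDimensional ℝ E]

/-- In finite dimension the affine hull of `D` is closed, so it contains `closure D` and is the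
whole space. Hence `D` has nonempty interior, and a convex set with nonempty interior has the same
interior as its closure. -/
theorem mem_interior_of_closure_mem_nhds {D : Set E} (hD : Convex ℝ D) {x : E}
    (hx : closure D ∈ 𝓝 x) : x ∈ interior D := by
  have hx' : x ∈ interior (closure D) := mem_interior_iff_mem_nhds.2 hx
  have hcl : closure D ⊆ affineSpan ℝ D :=
    closure_minimal (subset_affineSpan ℝ D) (affineSpan ℝ D).closed_of_finiteDimensional
  have htop : affineSpan ℝ D = ⊤ := by
    rw [eq_top_iff, ← isOpen_interior.affineSpan_eq_top ⟨x, hx'⟩]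
    exact affineSpan_le.2 (interior_subset.trans hcl)
  rwa [← hD.interior_closure_eq_interior_of_nonempty_interior
    (hD.interior_nonempty_iff_affineSpan_eq_top.2 htop)]

/-- Segments from points of a convex set `D` to a relative interior point of a set between `D` and
its closure can be prolonged slightly within `D`. -/
theorem eventually_prolong_mem {D Ω : Set E} (hD : Convex ℝ D) (hDΩ : D ⊆ Ω)
    (hΩ : Ω ⊆ closure D) {x : E} (hx : x ∈ intrinsicInterior ℝ Ω) {d : E} (hd : d ∈ D) :
    ∀ᶠ ε : ℝ in 𝓝 0, x - ε • (d - x) ∈ D := by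
  obtain ⟨⟨y, hyS⟩, hy, rfl⟩ := hx
  let S := affineSpan ℝ Ω
  have hDS : D ⊆ S := hDΩ.trans (subset_affineSpan ℝ Ω)
  -- Translating to the direction space of the affine hull turns relative interior into interior.
  let φ : S.direction → E := fun v => y + v
  have hφ : IsInducing φ :=
    (Homeomorph.addLeft y).isInducing.comp IsInducing.subtypeVal
  have himg : φ '' (φ ⁻¹' D) = D := by
    refine image_preimage_eq_of_subset fun z hz => ?_
    exact ⟨⟨z - y, AffineSubspace.vsub_mem_direction (hDS hz) hyS⟩, by simp [φ]⟩
  have hconv : Convex ℝ (φ ⁻¹' D) :=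
    (hD.translate_preimage_right y).linear_preimage S.direction.subtype
  let ψ : S.direction → S := fun v =>
    ⟨y + v, by
      have := AffineSubspace.vadd_mem_of_mem_direction v.2 hyS
      rwa [vadd_eq_add, add_comm] at this⟩
  have hψ : Continuous ψ := by fun_prop
  have hnhds : ψ ⁻¹' ((↑) ⁻¹' Ω) ∈ 𝓝 0 := by
    refine hψ.continuousAt.preimage_mem_nhds ?_
    have : ψ 0 = ⟨y, hyS⟩ := by simp [ψ]
    rw [this]
    exact mem_interior_iff_mem_nhds.1 hy
  have h0 : (0 : S.direction) ∈ interior (φ ⁻¹' D) := by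
    refine mem_interior_of_closure_mem_nhds hconv (Filter.mem_of_superset hnhds fun v hv => ?_)
    rw [hφ.closure_eq_preimage_closure_image, himg]
    exact hΩ hv
  let v : S.direction := ⟨d - y, AffineSubspace.vsub_mem_direction (hDS hd) hyS⟩
  have hcont : Continuous fun ε : ℝ => -(ε • v) := by fun_prop
  have hev := hcont.continuousAt (x := 0)
  have hmem := hev.preimage_mem_nhds (t := φ ⁻¹' D) (by
    simpa using mem_interior_iff_mem_nhds.1 h0)
  filter_upwards [hmem] with ε hε
  simpa [φ, v, sub_eq_add_neg] using hε

end RelativeInterior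

/-! ### Conjugates, epigraphs and the splitting of the dual variable. -/

section Conjugate

theorem image_fst_subset_effDom_and_subset_closure {E : Type*} [NormedAddCommGroup E] [NormedSpace ℝ E]
    {f : E → EReal} {C : Set (E × ℝ)} (hC : C ⊆ epi f) (hC' : epi f ⊆ closure C) :
    Prod.fst '' C ⊆ effDom f ∧ effDom f ⊆ closure (Prod.fst '' C) := by
  constructor
  · rintro _ ⟨p, hp, rfl⟩
    exact (show f p.1 ≤ p.2 from hC hp).trans_lt (EReal.coe_lt_top _)
  · intro x hx
    obtain ⟨c, hc, -⟩ := EReal.lt_iff_exists_real_btwn.1 (show f x < ⊤ from hx)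
    exact image_closure_subset_closure_image continuous_fst
      ⟨(x, c), hC' (show f x ≤ c from hc.le), rfl⟩

variable {E : Type*} [NormedAddCommGroup E] [InnerProductSpace ℝ E]

theorem fenchelConj_le_coe_iff {f : E → EReal} (hf : ∀ x, ⊥ < f x) {w : E} {c : ℝ} :
    fenchelConj f w ≤ c ↔ ∀ p ∈ epi f, inner ℝ w p.1 - p.2 ≤ c := by
  refine iSup_le_iff.trans ⟨fun h p hp => ?_, fun h x => ?_⟩
  · have h' := (EReal.sub_le_sub le_rfl (show f p.1 ≤ p.2 from hp)).trans (h p.1)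
    exact_mod_cast h'
  · have hb := hf x
    have hx : ∀ l : ℝ, f x = l → inner ℝ w x - l ≤ c := fun l hl => h (x, l) hl.le
    generalize f x = y at hb hx ⊢
    induction y with
    | bot => exact absurd hb (lt_irrefl _)
    | top => simp
    | coe l => exact_mod_cast hx l rfl

theorem bot_lt_fenchelConj {f : E → EReal} (hf : (effDom f).Nonempty) (w : E) :
    ⊥ < fenchelConj f w := by
  obtain ⟨x, hx⟩ := hf
  refine lt_of_lt_of_le ?_ (le_iSup (fun x => ((inner ℝ w x : ℝ) : EReal) - f x) x)
  replace hx : f x < ⊤ := hx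
  show ⊥ < ((inner ℝ w x : ℝ) : EReal) - f x
  generalize f x = y at hx ⊢
  induction y with
  | bot => simp
  | top => exact absurd hx (lt_irrefl _)
  | coe l => exact_mod_cast EReal.bot_lt_coe _

theorem fenchelConj_add_le {f₁ f₂ : E → EReal} (h₁ : ∀ x, ⊥ < f₁ x) (h₂ : ∀ x, ⊥ < f₂ x)
    (w₁ w₂ : E) :
    fenchelConj (fun x => f₁ x + f₂ x) (w₁ + w₂) ≤ fenchelConj f₁ w₁ + fenchelConj f₂ w₂ := by
  refine iSup_le fun x => ?_
  refine le_trans ?_ (add_le_add (le_iSup (fun x => ((inner ℝ w₁ x : ℝ) : EReal) - f₁ x) x)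
    (le_iSup (fun x => ((inner ℝ w₂ x : ℝ) : EReal) - f₂ x) x))
  have hb₁ := h₁ x
  have hb₂ := h₂ x
  simp only [inner_add_left]
  generalize f₁ x = y₁ at hb₁ ⊢
  generalize f₂ x = y₂ at hb₂ ⊢
  induction y₁ with
  | bot => exact absurd hb₁ (lt_irrefl _)
  | top => simp [EReal.top_add_of_ne_bot hb₂.ne']
  | coe a =>
    induction y₂ with
    | bot => exact absurd hb₂ (lt_irrefl _)
    | top => simp
    | coe b =>
      norm_cast
      exact le_of_eq (by ring)

variable [FiniteDimensional ℝ E]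

/-- The value of the conjugate of a sum is attained by a splitting of the dual variable. -/
theorem exists_fenchelConj_add_le {f₁ f₂ : E → EReal} (hp₁ : ProperFun f₁) (hp₂ : ProperFun f₂)
    (hc₁ : NearlyConvexFun f₁) (hc₂ : NearlyConvexFun f₂)
    (hri : (intrinsicInterior ℝ (effDom f₁) ∩ intrinsicInterior ℝ (effDom f₂)).Nonempty)
    {w : E} {r : ℝ} (hr : fenchelConj (fun x => f₁ x + f₂ x) w ≤ r) :
    ∃ w₁ w₂ : E, w = w₁ + w₂ ∧ fenchelConj f₁ w₁ + fenchelConj f₂ w₂ ≤ r := by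
  obtain ⟨C₁, hC₁, hCf₁, hfC₁⟩ := hc₁
  obtain ⟨C₂, hC₂, hCf₂, hfC₂⟩ := hc₂
  obtain ⟨x₀, hx₁, hx₂⟩ := hri
  have hsum : ∀ x a b, (x, a) ∈ epi f₁ → (x, b) ∈ epi f₂ → inner ℝ w x - (a + b) ≤ r := by
    intro x a b ha hb
    have hbot : ∀ x, ⊥ < f₁ x + f₂ x := fun x =>
      EReal.bot_lt_add_iff.2 ⟨hp₁.2 x, hp₂.2 x⟩
    refine (fenchelConj_le_coe_iff hbot).1 hr (x, a + b) ?_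
    show f₁ x + f₂ x ≤ ((a + b : ℝ) : EReal)
    rw [EReal.coe_add]
    exact add_le_add ha hb
  let T : (E × ℝ) × (E × ℝ) → E × ℝ :=
    fun q => (q.1.1 - q.2.1, q.1.2 + q.2.2 - inner ℝ w q.1.1 + r)
  have hA : Convex ℝ (T '' (C₁ ×ˢ C₂)) := by
    rintro _ ⟨p, hp, rfl⟩ _ ⟨q, hq, rfl⟩ a b ha hb hab
    refine ⟨a • p + b • q, (hC₁.prod hC₂) hp hq ha hb hab, ?_⟩
    have hr' : r = a * r + b * r := by rw [← add_mul, hab, one_mul]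
    ext
    · simp only [T, Prod.fst_add, Prod.snd_add, Prod.smul_fst, Prod.smul_snd]
      module
    · simp only [T, Prod.fst_add, Prod.snd_add, Prod.smul_fst, Prod.smul_snd, inner_add_right,
        inner_smul_right, smul_eq_mul]
      linear_combination hr'
  have hD₁ := image_fst_subset_effDom_and_subset_closure hCf₁ hfC₁
  have hD₂ := image_fst_subset_effDom_and_subset_closure hCf₂ hfC₂
  have hne : (T '' (C₁ ×ˢ C₂)).Nonempty := by
    refine Nonempty.image _ (Nonempty.prod ?_ ?_)
    · exact image_nonempty.1 (closure_nonempty_iff.1 (hp₁.1.mono hD₁.2))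
    · exact image_nonempty.1 (closure_nonempty_iff.1 (hp₂.1.mono hD₂.2))
  obtain ⟨g, hg⟩ := exists_linear_minorant hA hne (by
      rintro s ⟨⟨⟨x, a⟩, ⟨y, b⟩⟩, ⟨ha, hb⟩, h⟩
      simp only [T, Prod.mk.injEq, sub_eq_zero] at h
      obtain ⟨rfl, rfl⟩ := h
      linarith [hsum x a b (hCf₁ ha) (hCf₂ hb)]) (by
      rintro u s ⟨⟨⟨x, a⟩, ⟨y, b⟩⟩, ⟨ha, hb⟩, h⟩
      simp only [T, Prod.mk.injEq] at h
      have h₁ := eventually_prolong_mem (hC₁.linear_image (LinearMap.fst ℝ E ℝ)) hD₁.1 hD₁.2 hx₁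
        ⟨(x, a), ha, rfl⟩
      have h₂ := eventually_prolong_mem (hC₂.linear_image (LinearMap.fst ℝ E ℝ)) hD₂.1 hD₂.2 hx₂
        ⟨(y, b), hb, rfl⟩
      obtain ⟨ε, ⟨⟨p, hp, hpε⟩, ⟨q, hq, hqε⟩⟩, hε⟩ :=
        (((h₁.and h₂).filter_mono nhdsWithin_le_nhds).and
          (self_mem_nhdsWithin (s := Ioi (0 : ℝ)))).exists
      -- Both prolongations pass through `x₀` with the same `ε`, so `x₀` cancels in the difference.
      refine ⟨ε, hε, (T (p, q)).2, (p, q), ⟨hp, hq⟩, Prod.ext ?_ rfl⟩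
      simp only [LinearMap.fst_apply] at hpε hqε
      simp only [T, hpε, hqε, ← h.1]
      module)
  obtain ⟨y, hy⟩ : ∃ y : E, ∀ u, inner ℝ y u = g u :=
    ⟨(InnerProductSpace.toDual ℝ E).symm (LinearMap.toContinuousLinearMap g), fun u => by simp⟩
  have hclosed : IsClosed {q : (E × ℝ) × (E × ℝ) |
      0 ≤ inner ℝ y (q.1.1 - q.2.1) + (q.1.2 + q.2.2 - inner ℝ w q.1.1 + r)} :=
    isClosed_le continuous_const (by fun_prop)
  have hall : ∀ p ∈ epi f₁, ∀ q ∈ epi f₂,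
      0 ≤ inner ℝ y (p.1 - q.1) + (p.2 + q.2 - inner ℝ w p.1 + r) := by
    intro p hp q hq
    have hsub : C₁ ×ˢ C₂ ⊆ {q : (E × ℝ) × (E × ℝ) |
        0 ≤ inner ℝ y (q.1.1 - q.2.1) + (q.1.2 + q.2.2 - inner ℝ w q.1.1 + r)} := fun q hq => by
      simpa only [mem_ofPred_eq, hy] using hg (T q) (mem_image_of_mem T hq)
    refine closure_minimal hsub hclosed (?_ : (p, q) ∈ _)
    rw [closure_prod_eq]
    exact ⟨hfC₁ hp, hfC₂ hq⟩
  refine ⟨w - y, y, (sub_add_cancel w y).symm, ?_⟩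
  have hbound : ∀ q ∈ epi f₂, fenchelConj f₁ (w - y) ≤ ((r - (inner ℝ y q.1 - q.2) : ℝ) : EReal) := by
    intro q hq
    refine (fenchelConj_le_coe_iff hp₁.2).2 fun p hp => ?_
    have := hall p hp q hq
    rw [inner_sub_right] at this
    rw [inner_sub_left]
    linarith
  -- Finiteness allows the first conjugate to be subtracted from `r`, leaving a bound on the second.
  have hfin : fenchelConj f₁ (w - y) < ⊤ := by
    obtain ⟨x, hx⟩ := hp₂.1
    obtain ⟨c, hc, -⟩ := EReal.lt_iff_exists_real_btwn.1 (show f₂ x < ⊤ from hx)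
    exact (hbound (x, c) hc.le).trans_lt (EReal.coe_lt_top _)
  have hbot := bot_lt_fenchelConj hp₁.1 (w - y)
  generalize fenchelConj f₁ (w - y) = z at hbound hfin hbot ⊢
  induction z with
  | bot => exact absurd hbot (lt_irrefl _)
  | top => exact absurd hfin (lt_irrefl _)
  | coe a =>
    have h₂ : fenchelConj f₂ y ≤ ((r - a : ℝ) : EReal) := by
      refine (fenchelConj_le_coe_iff hp₂.2).2 fun q hq => ?_
      have := EReal.coe_le_coe_iff.1 (hbound q hq)
      linarith
    calc (a : EReal) + fenchelConj f₂ y ≤ a + ((r - a : ℝ) : EReal) := add_le_add le_rfl h₂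
      _ = r := by rw [← EReal.coe_add]; simp

end Conjugate

end NearConvexity

theorem theorem6p6 (n : ℕ) (f₁ f₂ : EuclideanSpace ℝ (Fin n) → EReal)
    (hp₁ : NearConvexity.ProperFun f₁) (hp₂ : NearConvexity.ProperFun f₂)
    (hc₁ : NearConvexity.NearlyConvexFun f₁) (hc₂ : NearConvexity.NearlyConvexFun f₂)
    (hri : (intrinsicInterior ℝ (NearConvexity.effDom f₁) ∩
      intrinsicInterior ℝ (NearConvexity.effDom f₂)).Nonempty) :
    (∀ w : EuclideanSpace ℝ (Fin n),
      NearConvexity.fenchelConj (fun x => f₁ x + f₂ x) w =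
        NearConvexity.infConv (NearConvexity.fenchelConj f₁) (NearConvexity.fenchelConj f₂) w) ∧
    (∀ w : EuclideanSpace ℝ (Fin n),
      (∃ r : ℝ, NearConvexity.fenchelConj (fun x => f₁ x + f₂ x) w = (r : EReal)) →
        ∃ w₁ w₂ : EuclideanSpace ℝ (Fin n), w = w₁ + w₂ ∧
          NearConvexity.fenchelConj (fun x => f₁ x + f₂ x) w =
            NearConvexity.fenchelConj f₁ w₁ + NearConvexity.fenchelConj f₂ w₂) := by
  have hle : ∀ w₁ w₂ w, w₁ + w₂ = w → NearConvexity.fenchelConj (fun x => f₁ x + f₂ x) w ≤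
      NearConvexity.fenchelConj f₁ w₁ + NearConvexity.fenchelConj f₂ w₂ := by
    rintro w₁ w₂ _ rfl
    exact NearConvexity.fenchelConj_add_le hp₁.2 hp₂.2 w₁ w₂
  have hex : ∀ w, ∀ r : ℝ, NearConvexity.fenchelConj (fun x => f₁ x + f₂ x) w = (r : EReal) →
      ∃ w₁ w₂ : EuclideanSpace ℝ (Fin n), w = w₁ + w₂ ∧
        NearConvexity.fenchelConj (fun x => f₁ x + f₂ x) w =
          NearConvexity.fenchelConj f₁ w₁ + NearConvexity.fenchelConj f₂ w₂ := by
    intro w r hr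
    obtain ⟨w₁, w₂, hw, h⟩ :=
      NearConvexity.exists_fenchelConj_add_le hp₁ hp₂ hc₁ hc₂ hri hr.le
    exact ⟨w₁, w₂, hw, le_antisymm (hle w₁ w₂ w hw.symm) (h.trans hr.ge)⟩
  refine ⟨fun w => le_antisymm ?_ ?_, fun w ⟨r, hr⟩ => hex w r hr⟩
  · refine le_sInf ?_
    rintro _ ⟨w₁, w₂, hw, rfl⟩
    exact hle w₁ w₂ w hw
  · obtain ⟨x₀, hx₁, hx₂⟩ := hri
    have hd₁ : f₁ x₀ < ⊤ := (intrinsicInterior_subset hx₁ : x₀ ∈ NearConvexity.effDom f₁)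
    have hd₂ : f₂ x₀ < ⊤ := (intrinsicInterior_subset hx₂ : x₀ ∈ NearConvexity.effDom f₂)
    have hbot : ⊥ < NearConvexity.fenchelConj (fun x => f₁ x + f₂ x) w :=
      NearConvexity.bot_lt_fenchelConj (f := fun x => f₁ x + f₂ x) ⟨x₀,
        EReal.add_lt_top hd₁.ne hd₂.ne⟩ w
    rcases eq_or_ne (NearConvexity.fenchelConj (fun x => f₁ x + f₂ x) w) ⊤ with htop | htop
    · rw [htop]
      exact le_top
    · obtain ⟨w₁, w₂, hw, h⟩ := hex w _ (EReal.coe_toReal htop hbot.ne').symm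
      exact sInf_le ⟨w₁, w₂, hw.symm, h⟩
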